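/- **Theorem 2 (q-P$_{\rm III}$).** Let $\alpha,\beta,\gamma,\delta\in\mathbb C$, $\xi_0\in\mathbb C\setminus\{0\}$, and for large $|\eta|$ put $q=1+\frac1\eta$, $n=\eta^2+m$, $\xi=\xi_0q^{n}$. Consider $$w(q\xi)\,w(\xi/q)=\frac{cd\,(w-\tilde a\xi)(w-\tilde b\xi)}{(w-c)(w-d)},\qquad \tilde a=\frac{\alpha}{\xi_0},\ \tilde b=\frac{\beta}{\xi_0},\ c=e^{\eta-\frac12}\gamma,\ d=e^{\eta-\frac12}\delta ,$$ and scale $u=e^{\frac12-\eta}w$, regarded as a function of $m$ (so $\xi\mapsto q\xi$ is $m\mapsto m+1$). Let $\phi,a,p$ be admissible: $a\ne0$ and $p\notin\{0,a,\alpha,\beta,\gamma,\delta\}$. *Leading order.* Let $U$ be an elliptic function of $m$ with $\mathbb R$-independent periods $\omega_1,\omega_2$ such that $$U_{m+1}U_{m-1}=\frac{\gamma\delta(U_m-\alpha)(U_m-\beta)}{(U_m-\gamma)(U_m-\delta)},\qquad U_\phi=a,\quad U_{\phi+1}=p,\quad U'(\phi)\neq0\qquad\Bigl({}'=\tfrac{d}{dm}\Bigr),$$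 and such that $E_{\rm III}$ below, evaluated at $U$, is a constant independent of $m$. Put $F_m=(U_{m+1}-U_{m-1})(U_m-\gamma)(U_m-\delta)$. *Domain.* Let $\mathcal D_0\ni\phi$ be open, $M\in\mathbb N$, and $\mathcal D=\bigcup_{j=0}^{M}(\mathcal D_0+j)$, with $\phi+\omega_i\in\bigcup_{j=0}^{M-1}(\mathcal D_0+j)$ for $i=1,2$. Assume that for every $m\in\mathcal D$ the function $U$ has no pole at $m-1,m,m+1$, and $U_m\ne0$, $F_m\neq0$. *Sums.* Since $m$ and $\Omega_i$ are complex, $\sum_{k=\phi}^{m-1}f_k$ is understood in the sense of the calculus of differences: it is an analytic function $S$ of $m\in\mathcal D$ with $S_\phi=0$, $S_{m+1}-S_m=f_m$, and $\sum_{k=r}^{t}f_k=S_{t+1}-S_{r}$. For $m-\phi\in\mathbb N$ this is the ordinary sum when $\phi,\dots,m\in\mathcal D$; otherwise it is fixed only up to a function of period $1$, which is fixed by the initial functions of $u$, as stated next. *Solution.* Let $u=U+s$ be, for all large $\eta$ (along any filter finer than $|\eta|\to\infty$), a solution of this equation, analytic in $m\in\mathcal D$, with $u(\phi)=a$, $u(\phi+1)=p$.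 Let its initial functions satisfy $s_m=\sigma_m/\eta+\mathcal O(\eta^{-2})$ locally uniformly on $\mathcal D_0\cup(\mathcal D_0+1)$, for some function $\sigma$ independent of $\eta$. Let $$\begin{aligned}s^{(1)}_m=F_m\sum_{l=\phi}^{m-1}\Bigl(&E_1\frac{U_{l+1}U_l}{F_{l+1}F_l}+\frac{(\alpha+\beta)\gamma\delta}{3\eta}\frac{(3l+4)(U_{l+1}+U_l)}{F_{l+1}F_l}-\frac{2\alpha\beta\gamma\delta}{3\eta}\frac{3l+4}{F_{l+1}F_l}\\&+\frac{2\alpha\beta\gamma\delta}{\eta}\frac{U_{l+1}U_l}{F_{l+1}F_l}\sum_{k=\phi}^{l}\frac1{U_{k+1}U_k}-\frac{(\alpha+\beta)\gamma\delta}{\eta}\frac{U_{l+1}U_l}{F_{l+1}F_l}\sum_{k=\phi}^{l}\Bigl(\frac1{U_{k+1}}+\frac1{U_k}\Bigr)\Bigr),\end{aligned}$$ $$E_1=\frac{2\alpha\beta\gamma\delta(3\phi+1)}{3\eta\,U_{\phi+1}U_\phi}-\frac{(\alpha+\beta)\gamma\delta}{3\eta}\Bigl(\frac{3\phi+1}{U_{\phi+1}}+\frac{3\phi+1}{U_\phi}\Bigr),$$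 where the extension of the sums to non-integer ranges is adapted to $u$: $s^{(1)}_m=\sigma_m/\eta$ on $\mathcal D_0\cup(\mathcal D_0+1)$. *Energy.* Writing $\overline u=u_{m+1}$, let $$E_{\rm III}=\frac{\overline u^2u^2-(\gamma+\delta)\overline uu(\overline u+u)+\gamma\delta(\overline u^2+u^2)-(\alpha+\beta)\gamma\delta(\overline u+u)+\alpha\beta\gamma\delta}{\overline uu}.$$ Then $s_m=s^{(1)}_m+\mathcal O(\eta^{-2})$ locally uniformly on $\mathcal D$. For $i=1,2$ and all sufficiently large $\eta$ there exist approximate-periods $\Omega_i$, that is, $u(\phi+\Omega_i)=u(\phi)$ with $\Omega_i\to\omega_i$; and all such $\Omega_i$ satisfy $$\begin{aligned}E_{\rm III}(\phi+\Omega_i)-E_{\rm III}(\phi)={}&\frac{(\alpha+\beta)\gamma\delta}{\eta}\Bigl(\Bigl(\frac1{U_{\phi+1}}+\frac1{U_\phi}\Bigr)\omega_i-\sum_{k=\phi+1}^{\phi+\Omega_i}\Bigl(\frac1{U_{k+1}}+\frac1{U_k}\Bigr)\Bigr)\\&-\frac{2\alpha\beta\gamma\delta}{\eta}\frac{\omega_i}{U_{\phi+1}U_\phi}+\frac{2\alpha\beta\gamma\delta}{\eta}\sum_{k=\phi+1}^{\phi+\Omega_i}\frac1{U_{k+1}U_k}+\mathcal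 O\Bigl(\frac1{\eta^2}\Bigr),\end{aligned}$$ $$\Omega_i=\omega_i-\frac{s(\phi+\omega_i)}{U'(\phi)}+o\bigl(s(\phi+\omega_i)\bigr),\qquad \Omega_i=\omega_i-\frac{s^{(1)}(\phi+\omega_i)}{U'(\phi)}+\mathcal O\Bigl(\frac1{\eta^2}\Bigr).$$ -/

import Mathlib

open Filter Topology Asymptotics

namespace QP3

noncomputable section

/-- The independent variable `ξ = ξ₀ q ^ n` with `q = 1 + 1 / η` and `n = η ^ 2 + m`. -/
def xi (ξ₀ η m : ℂ) : ℂ := ξ₀ * (1 + 1 / η) ^ (η ^ 2 + m)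

/-- `w`, as a function of `m`, is a differentiable solution on `D` of q-P_III
`w(qξ) w(ξ/q) = c d (w - aξ) (w - bξ) / ((w - c) (w - d))`.  The step `ξ ↦ qξ` is `m ↦ m + 1`.
The equation is written with cleared denominators, so that no value of a division by zero
enters. -/
structure IsSolution (ξ₀ a b c d η : ℂ) (D : Set ℂ) (w : ℂ → ℂ) : Prop where
  differentiableOn : DifferentiableOn ℂ w D
  equation : ∀ m, m - 1 ∈ D → m ∈ D → m + 1 ∈ D →
    w (m + 1) * w (m - 1) * ((w m - c) * (w m - d)) =
      c * d * (w m - a * xi ξ₀ η m) * (w m - b * xi ξ₀ η m)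

/-- The scaling `u = e^{1/2 - η} w`. -/
def scaled (w : ℂ → ℂ → ℂ) (η m : ℂ) : ℂ := Complex.exp (1 / 2 - η) * w η m

/-- Numerator of the energy, at `x` (the forward iterate) and `y`. -/
def energyNum (α β γ δ x y : ℂ) : ℂ :=
  x ^ 2 * y ^ 2 - (γ + δ) * (x * y) * (x + y) + γ * δ * (x ^ 2 + y ^ 2)
    - (α + β) * γ * δ * (x + y) + α * β * γ * δ

/-- The QRT-type energy `E_III` of a function `u` at `m`. -/
def energy (α β γ δ : ℂ) (u : ℂ → ℂ) (m : ℂ) : ℂ :=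
  energyNum α β γ δ (u (m + 1)) (u m) / (u (m + 1) * u m)

/-- `U` is an elliptic function with the independent periods `ω 0`, `ω 1` which solves the
autonomous leading-order equation and parametrises one curve `E_III = E₀`. -/
structure IsLeadingOrder (α β γ δ : ℂ) (ω : Fin 2 → ℂ) (U : ℂ → ℂ) : Prop where
  meromorphic : MeromorphicOn U Set.univ
  indep : LinearIndependent ℝ ω
  periodic : ∀ i, Function.Periodic U (ω i)
  equation : ∀ m, AnalyticAt ℂ U (m - 1) → AnalyticAt ℂ U m → AnalyticAt ℂ U (m + 1) →
    U (m + 1) * U (m - 1) * ((U m - γ) * (U m - δ)) = γ * δ * (U m - α) * (U m - β)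
  invariant : ∃ E₀ : ℂ, ∀ m, AnalyticAt ℂ U m → AnalyticAt ℂ U (m + 1) →
    energyNum α β γ δ (U (m + 1)) (U m) = E₀ * (U (m + 1) * U m)

/-- Admissible initial values `u(φ) = a`, `u(φ + 1) = p`. -/
structure Admissible (α β γ δ a p : ℂ) : Prop where
  a_ne_zero : a ≠ 0
  p_ne_zero : p ≠ 0
  p_ne_a : p ≠ a
  p_ne_α : p ≠ α
  p_ne_β : p ≠ β
  p_ne_γ : p ≠ γ
  p_ne_δ : p ≠ δ

/-- `F_m = (U_{m+1} - U_{m-1}) (U_m - γ) (U_m - δ)`. -/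
def F (γ δ : ℂ) (U : ℂ → ℂ) (m : ℂ) : ℂ :=
  (U (m + 1) - U (m - 1)) * (U m - γ) * (U m - δ)

/-- The union of the initial domain `D₀` and its first `M` translates. -/
def iterates (D₀ : Set ℂ) (M : ℕ) : Set ℂ := {m | ∃ j : ℕ, j ≤ M ∧ m - (j : ℂ) ∈ D₀}

/-- On `D`, the function `U` and its neighbouring iterates have no poles, and `U` and `F` have
no zeros. -/
def IsRegularOn (γ δ : ℂ) (U : ℂ → ℂ) (D : Set ℂ) : Prop :=
  ∀ m ∈ D, AnalyticAt ℂ U (m - 1) ∧ AnalyticAt ℂ U m ∧ AnalyticAt ℂ U (m + 1) ∧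
    U m ≠ 0 ∧ F γ δ U m ≠ 0

/-- `S m` is the sum `∑_{k=φ}^{m-1} f k`, for complex `m`, in the sense of the calculus of
differences: `S φ = 0` and `S (m + 1) - S m = f m`.  Where `m - φ` is a natural number, `S m` is
the ordinary sum; the sum from `k = r` to `k = t` is `S (t + 1) - S r`. -/
structure IsSum (φ : ℂ) (D : Set ℂ) (f S : ℂ → ℂ) : Prop where
  base : S φ = 0
  step : ∀ m ∈ D, m + 1 ∈ D → S (m + 1) = S m + f m
  analytic : AnalyticOnNhd ℂ S D

/-- The term `1 / U_{k+1} + 1 / U_k`. -/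
def sumTerm (U : ℂ → ℂ) (k : ℂ) : ℂ := 1 / U (k + 1) + 1 / U k

/-- The term `1 / (U_{k+1} U_k)`. -/
def prodTerm (U : ℂ → ℂ) (k : ℂ) : ℂ := 1 / (U (k + 1) * U k)

/-- The constant `η E₁`. -/
def e₁ (α β γ δ φ : ℂ) (U : ℂ → ℂ) : ℂ :=
  2 * α * β * γ * δ * (3 * φ + 1) / (3 * (U (φ + 1) * U φ))
    - (α + β) * γ * δ / 3 * ((3 * φ + 1) / U (φ + 1) + (3 * φ + 1) / U φ)

/-- `η` times the `l`-th term of the outer sum in the leading-order behaviour of `s`.  Here `A`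
and `B` are the sums from `φ` of `sumTerm U` and `prodTerm U`, so that `A (l + 1)` and
`B (l + 1)` are the inner sums `∑_{k=φ}^{l}`. -/
def nestedTerm (α β γ δ φ : ℂ) (U A B : ℂ → ℂ) (l : ℂ) : ℂ :=
  e₁ α β γ δ φ U * (U (l + 1) * U l / (F γ δ U (l + 1) * F γ δ U l))
    + (α + β) * γ * δ / 3 * ((3 * l + 4) * (U (l + 1) + U l) / (F γ δ U (l + 1) * F γ δ U l))
    - 2 * α * β * γ * δ / 3 * ((3 * l + 4) / (F γ δ U (l + 1) * F γ δ U l))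
    + 2 * α * β * γ * δ * (U (l + 1) * U l / (F γ δ U (l + 1) * F γ δ U l)) * B (l + 1)
    - (α + β) * γ * δ * (U (l + 1) * U l / (F γ δ U (l + 1) * F γ δ U l)) * A (l + 1)

/-- The leading-order behaviour of `s`, where `T` is the sum from `φ` of `nestedTerm`; the
common factor `1 / η` of all the terms is taken out of the sum. -/
def sLead (γ δ : ℂ) (U T : ℂ → ℂ) (η m : ℂ) : ℂ := F γ δ U m * (1 / η * T m)

/-- `Ω` is an approximate-period of `u` at `φ` in the direction of the period `ω`, along `l`. -/
structure IsApproxPeriod (l : Filter ℂ) (u : ℂ → ℂ → ℂ) (φ ω : ℂ) (Ω : ℂ → ℂ) : Prop where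
  returns : ∀ᶠ η in l, u η (φ + Ω η) = u η φ
  tendsto : Tendsto Ω l (𝓝 ω)

end

end QP3

/-! After scaling, the only non-autonomous ingredient is `kappa`, which multiplies α and β and
equals 1 + (m + 1/3)/η + O(η⁻²). With u = U + v/η, the order 1/η part of the equation is a forced,
linear, second-order difference equation for v.

The energy integrates it. Over a fixed value y, the curve E = E₀ is a quadratic in x with leading
coefficient (y - γ)(y - δ) and roots U_{m±1}. By Vieta, its derivative at a root is F_m. Hence the
first variation of the energy numerator is F_m v_{m+1} - F_{m+1} v_m = U_{m+1} U_m e_m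
(`energy_variation`), where e is `energyCoeff`. Division by F_{m+1} F_m makes v/F telescope, which
produces the nested sum. Conversely, two consecutive relations of this kind, with the right
increment of e, give back the linearised equation (`linearized_of_energy`, `energyCoeff_sub`). The
equation can be solved for u_{m+1} because its cofactor has a nonzero limit, so the expansion
propagates from D₀ and D₀ + 1 to all iterates (`Approx.succ`).

For the approximate-periods, u - U is analytic and O(1/η), so by Cauchy's estimate its derivative is
O(1/η) too. Thus u inherits the local invertibility of U near φ + ω_i, with uniform constants. This
yields the return points and their expansions. The energy change is then e at φ + Ω_i, where
periodicity of U removes the terms comparing U there with U at φ, up to O(η⁻²). -/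

namespace QP3

/-! ### Calculus of first-order expansions along a filter -/

/-- `f = f₀ + ε f₁ + O(ε²)` along `L`, with bounded coefficients. -/
structure FirstOrder {X : Type*} (L : Filter X) (ε f f₀ f₁ : X → ℂ) : Prop where
  bdd₀ : f₀ =O[L] fun _ => (1 : ℂ)
  bdd₁ : f₁ =O[L] fun _ => (1 : ℂ)
  remainder : (fun x => f x - f₀ x - ε x * f₁ x) =O[L] fun x => ε x ^ 2

namespace FirstOrder

variable {X : Type*} {L : Filter X} {ε f f₀ f₁ g g₀ g₁ : X → ℂ}

theorem congr' (h : FirstOrder L ε f f₀ f₁) {f' f₀' f₁' : X → ℂ} (hf : f =ᶠ[L] f')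
    (h₀ : f₀ =ᶠ[L] f₀') (h₁ : f₁ =ᶠ[L] f₁') : FirstOrder L ε f' f₀' f₁' :=
  ⟨h.bdd₀.congr' h₀ .rfl, h.bdd₁.congr' h₁ .rfl,
    h.remainder.congr' (by filter_upwards [hf, h₀, h₁] with x a b c; rw [a, b, c]) .rfl⟩

theorem const (c : ℂ) : FirstOrder L ε (fun _ => c) (fun _ => c) (fun _ => 0) :=
  ⟨isBigO_const_const _ one_ne_zero _, isBigO_zero _ _, by simpa using isBigO_zero _ _⟩

theorem add (hf : FirstOrder L ε f f₀ f₁) (hg : FirstOrder L ε g g₀ g₁) :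
    FirstOrder L ε (fun x => f x + g x) (fun x => f₀ x + g₀ x) (fun x => f₁ x + g₁ x) :=
  ⟨hf.bdd₀.add hg.bdd₀, hf.bdd₁.add hg.bdd₁,
    (hf.remainder.add hg.remainder).congr_left fun x => by ring⟩

theorem sub (hf : FirstOrder L ε f f₀ f₁) (hg : FirstOrder L ε g g₀ g₁) :
    FirstOrder L ε (fun x => f x - g x) (fun x => f₀ x - g₀ x) (fun x => f₁ x - g₁ x) :=
  ⟨hf.bdd₀.sub hg.bdd₀, hf.bdd₁.sub hg.bdd₁,
    (hf.remainder.sub hg.remainder).congr_left fun x => by ring⟩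

theorem sub_isBigO (hε : Tendsto ε L (𝓝 0)) (hf : FirstOrder L ε f f₀ f₁) :
    (fun x => f x - f₀ x) =O[L] ε := by
  have hε1 : ε =O[L] fun _ => (1 : ℂ) := hε.isBigO_one ℂ
  have h1 : (fun x => ε x * f₁ x) =O[L] ε := by
    simpa using (isBigO_refl ε L).mul hf.bdd₁
  have h2 : (fun x => ε x ^ 2) =O[L] ε := by
    simpa [sq] using (isBigO_refl ε L).mul hε1
  exact ((hf.remainder.trans h2).add h1).congr_left fun x => by ring

theorem bdd (hε : Tendsto ε L (𝓝 0)) (hf : FirstOrder L ε f f₀ f₁) :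
    f =O[L] fun _ => (1 : ℂ) :=
  (((hf.sub_isBigO hε).trans (hε.isBigO_one ℂ)).add hf.bdd₀).congr_left fun x => by ring

theorem mul (hε : Tendsto ε L (𝓝 0)) (hf : FirstOrder L ε f f₀ f₁)
    (hg : FirstOrder L ε g g₀ g₁) :
    FirstOrder L ε (fun x => f x * g x) (fun x => f₀ x * g₀ x)
      (fun x => f₀ x * g₁ x + f₁ x * g₀ x) := by
  have hε1 : ε =O[L] fun _ => (1 : ℂ) := hε.isBigO_one ℂ
  have b0 := hf.bdd₀.mul hg.bdd₀
  have b1 := (hf.bdd₀.mul hg.bdd₁).add (hf.bdd₁.mul hg.bdd₀)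
  have be := hε1.mul hf.bdd₁
  have r1 := hf.remainder.mul (hg.bdd hε)
  simp only [mul_one] at be
  have r2 := hg.remainder.mul (hf.bdd₀.add be)
  have r3 := (isBigO_refl (fun x => ε x ^ 2) L).mul (hf.bdd₁.mul hg.bdd₁)
  simp only [mul_one] at b0 b1 r1 r2 r3
  exact ⟨b0, b1, ((r1.add r2).add r3).congr_left fun x => by ring⟩

theorem const_mul (hε : Tendsto ε L (𝓝 0)) (c : ℂ) (hf : FirstOrder L ε f f₀ f₁) :
    FirstOrder L ε (fun x => c * f x) (fun x => c * f₀ x) (fun x => c * f₁ x) :=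
  ((const c).mul hε hf).congr' .rfl .rfl (.of_forall fun x => by simp)

theorem comp {Y : Type*} {L' : Filter Y} (h : FirstOrder L ε f f₀ f₁) {k : Y → X}
    (hk : Tendsto k L' L) :
    FirstOrder L' (fun y => ε (k y)) (fun y => f (k y)) (fun y => f₀ (k y)) (fun y => f₁ (k y)) :=
  ⟨h.bdd₀.comp_tendsto hk, h.bdd₁.comp_tendsto hk, h.remainder.comp_tendsto hk⟩

/-- If the product of `f` with a function bounded away from zero is `O(ε²)`, so is `f`. -/
theorem isBigO_of_mul {k : X → ℂ} {c : ℂ} (hc : c ≠ 0) (hg : Tendsto g L (𝓝 c))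
    (h : (fun x => k x * g x) =O[L] fun x => ε x ^ 2) : k =O[L] fun x => ε x ^ 2 := by
  have hi : (fun x => (g x)⁻¹) =O[L] fun _ => (1 : ℂ) := (hg.inv₀ hc).isBigO_one ℂ
  have := h.mul hi
  simp only [mul_one] at this
  refine this.congr' ?_ .rfl
  filter_upwards [hg.eventually_ne hc] with x hx
  field_simp

theorem tendsto (hε : Tendsto ε L (𝓝 0)) (hf : FirstOrder L ε f f₀ f₁) {c : ℂ}
    (h₀ : Tendsto f₀ L (𝓝 c)) : Tendsto f L (𝓝 c) := by
  have := ((hf.sub_isBigO hε).trans_tendsto hε).add h₀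
  simpa using this

end FirstOrder

/-! ### Expansion of the independent variable -/

/-- The ratio of the independent variable to its leading-order size. -/
noncomputable def kappa (η m : ℂ) : ℂ :=
  Complex.exp (1 / 2 - η) * (1 + 1 / η) ^ (η ^ 2 + m)

theorem tendsto_one_div {l : Filter ℂ} (hl : l ≤ Bornology.cobounded ℂ) :
    Tendsto (fun η : ℂ => 1 / η) l (𝓝 0) := by
  simpa using (tendsto_inv₀_cobounded (α := ℂ)).mono_left hl

theorem log_one_add_isBigO :
    (fun z : ℂ => Complex.log (1 + z) - (z - z ^ 2 / 2 + z ^ 3 / 3)) =O[𝓝 0] fun z => z ^ 4 :=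
  (Complex.log_sub_logTaylor_isBigO 3).congr_left fun z => by
    simp [Complex.logTaylor, Finset.sum_range_succ]; ring

/-- The exponent 1/2 - η + (η² + m) log(1 + 1/η) equals (m + 1/3)/η + O(η⁻²): the cubic term of the
logarithm gives the 1/3. The factor η² is why the logarithm is needed up to O(η⁻⁴). -/
theorem kappa_firstOrder {l : Filter ℂ} (hl : l ≤ Bornology.cobounded ℂ) (c : ℂ) :
    FirstOrder (l ×ˢ 𝓝 c) (fun x => 1 / x.1) (fun x => kappa x.1 x.2) (fun _ => 1)
      (fun x => x.2 + 1 / 3) := by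
  have hε : Tendsto (fun x : ℂ × ℂ => 1 / x.1) (l ×ˢ 𝓝 c) (𝓝 0) :=
    (tendsto_one_div hl).comp tendsto_fst
  have hε1 := hε.isBigO_one ℂ
  have hm : (fun x : ℂ × ℂ => x.2) =O[l ×ˢ 𝓝 c] fun _ => (1 : ℂ) :=
    (tendsto_snd (f := l) (g := 𝓝 c)).isBigO_one ℂ
  have hne : ∀ᶠ x : ℂ × ℂ in l ×ˢ 𝓝 c, x.1 ≠ 0 :=
    tendsto_fst.eventually (hl (Bornology.eventually_ne_cobounded 0))
  have hlog := log_one_add_isBigO.comp_tendsto hε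
  have hk : (fun x : ℂ × ℂ => x.2 + 1 / 3) =O[l ×ˢ 𝓝 c] fun _ => (1 : ℂ) :=
    hm.add (isBigO_const_const _ one_ne_zero _)
  set R : ℂ × ℂ → ℂ := fun x => 1 / 2 - x.1 + (x.1 ^ 2 + x.2) * Complex.log (1 + 1 / x.1) with hR
  have hRO : (fun x => R x - 1 / x.1 * (x.2 + 1 / 3)) =O[l ×ˢ 𝓝 c]
      fun x => (1 / x.1) ^ 2 := by
    -- `t1` is the Taylor remainder times η² + m; `t2` collects the products of m with the quadratic
    -- and cubic Taylor terms.
    have t1 : (fun x : ℂ × ℂ => (1 + x.2 * (1 / x.1) ^ 2) * ((Complex.log (1 + 1 / x.1) -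
        (1 / x.1 - (1 / x.1) ^ 2 / 2 + (1 / x.1) ^ 3 / 3)) * x.1 ^ 2)) =O[l ×ˢ 𝓝 c]
        fun x => (1 / x.1) ^ 2 := by
      have b : (fun x : ℂ × ℂ => (1 + x.2 * (1 / x.1) ^ 2)) =O[l ×ˢ 𝓝 c] fun _ => (1 : ℂ) :=
        (isBigO_refl _ _).add (by simpa using hm.mul (hε1.pow 2))
      have := b.mul (hlog.mul (isBigO_refl (fun x : ℂ × ℂ => x.1 ^ 2) _))
      refine this.congr' .rfl ?_
      filter_upwards [hne] with x hx
      simp only [Function.comp]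
      field_simp
    have t2 : (fun x : ℂ × ℂ => (1 / x.1) ^ 2 * (x.2 * (-1 / 2 + 1 / x.1 / 3))) =O[l ×ˢ 𝓝 c]
        fun x => (1 / x.1) ^ 2 := by
      have b : (fun x : ℂ × ℂ => (-1 / 2 + 1 / x.1 / 3)) =O[l ×ˢ 𝓝 c] fun _ => (1 : ℂ) :=
        (isBigO_const_const _ one_ne_zero _).add
          ((hε1.const_mul_left (1 / 3)).congr_left fun x => by ring)
      simpa only [mul_one] using (isBigO_refl (fun x : ℂ × ℂ => (1 / x.1) ^ 2) _).mul (hm.mul b)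
    refine (t1.add t2).congr' ?_ .rfl
    filter_upwards [hne] with x hx
    simp only [hR]
    field_simp
    ring
  have hRε : R =O[l ×ˢ 𝓝 c] fun x => 1 / x.1 := by
    have h1 := hRO.trans (show (fun x : ℂ × ℂ => (1 / x.1) ^ 2) =O[l ×ˢ 𝓝 c] fun x => 1 / x.1 by
      simpa [sq] using (isBigO_refl (fun x : ℂ × ℂ => 1 / x.1) _).mul hε1)
    have h2 := (isBigO_refl (fun x : ℂ × ℂ => 1 / x.1) (l ×ˢ 𝓝 c)).mul hk
    simp only [mul_one] at h2
    exact (h1.add h2).congr_left fun x => by ring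
  have hexp : (fun z : ℂ => Complex.exp z - 1 - z) =O[𝓝 0] fun z => z ^ 2 := by
    refine IsBigO.of_bound 1 ?_
    filter_upwards [Metric.ball_mem_nhds (0 : ℂ) one_pos] with z hz
    have hz : ‖z‖ < 1 := by simpa using hz
    simpa using Complex.norm_exp_sub_one_sub_id_le hz.le
  have hE := (hexp.comp_tendsto (hRε.trans_tendsto hε)).trans (hRε.pow 2)
  refine ⟨isBigO_refl _ _, hk, ?_⟩
  refine (hE.add hRO).congr' ?_ .rfl
  filter_upwards [hne, (hε.const_add 1).eventually_ne (b₂ := 0) (by simp)] with x hx h1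
  simp only [Function.comp, kappa]
  rw [Complex.cpow_def_of_ne_zero h1, ← Complex.exp_add,
    show 1 / 2 - x.1 + Complex.log (1 + 1 / x.1) * (x.1 ^ 2 + x.2) = R x by simp only [hR]; ring]
  ring

/-! ### Algebra of the energy curve and the scaled equation -/

/-- The coefficient of `1 / η` in the energy of a solution with initial energy equal to that
of `U`. -/
noncomputable def energyCoeff (α β γ δ φ : ℂ) (U A B : ℂ → ℂ) (l : ℂ) : ℂ :=
  e₁ α β γ δ φ U + (α + β) * γ * δ / 3 * ((3 * l + 4) * (1 / U (l + 1) + 1 / U l))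
    - 2 * α * β * γ * δ / 3 * ((3 * l + 4) / (U (l + 1) * U l))
    + 2 * α * β * γ * δ * B (l + 1) - (α + β) * γ * δ * A (l + 1)

theorem nestedTerm_mul {α β γ δ φ l : ℂ} {U A B : ℂ → ℂ} (h₁ : U (l + 1) ≠ 0) (h₀ : U l ≠ 0)
    (hF₁ : F γ δ U (l + 1) ≠ 0) (hF₀ : F γ δ U l ≠ 0) :
    F γ δ U (l + 1) * F γ δ U l * nestedTerm α β γ δ φ U A B l =
      U (l + 1) * U l * energyCoeff α β γ δ φ U A B l := by
  unfold nestedTerm energyCoeff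
  field_simp
  ring

/-- Summation by parts: the new term of each inner sum lowers the weight c + 4/3 to c + 1/3, leaving
c + 1/3 times a difference of reciprocals. This weight is the first-order coefficient of `kappa`, so
the increment is exactly the forcing. -/
theorem energyCoeff_sub {α β γ δ φ c : ℂ} {U A B : ℂ → ℂ} (h₁ : U (c + 1) ≠ 0) (h₀ : U c ≠ 0)
    (h₂ : U (c - 1) ≠ 0) (hA : A (c + 1) = A c + sumTerm U c)
    (hB : B (c + 1) = B c + prodTerm U c) :
    (energyCoeff α β γ δ φ U A B c - energyCoeff α β γ δ φ U A B (c - 1)) *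
        (U (c + 1) * U c * U (c - 1)) =
      γ * δ * (c + 1 / 3) * (U (c + 1) - U (c - 1)) * (-(α + β) * U c + 2 * α * β) := by
  unfold energyCoeff
  rw [sub_add_cancel, hA, hB]
  unfold sumTerm prodTerm
  field_simp
  ring

theorem energyNum_comm (α β γ δ x y : ℂ) :
    energyNum α β γ δ x y = energyNum α β γ δ y x := by
  unfold energyNum; ring

/-- Vieta's formula for the two points of the curve over `y`. -/
theorem sum_of_energyNum_eq {α β γ δ E₀ x x' y : ℂ} (hne : x ≠ x')
    (h : energyNum α β γ δ x y = E₀ * (x * y)) (h' : energyNum α β γ δ x' y = E₀ * (x' * y)) :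
    (y - γ) * (y - δ) * (x + x') = (γ + δ) * y ^ 2 + (α + β) * γ * δ + E₀ * y := by
  apply mul_left_cancel₀ (sub_ne_zero.mpr hne)
  unfold energyNum at h h'
  linear_combination h - h'

/-- Two consecutive variations of the energy determine the linearised equation. -/
theorem linearized_of_energy {α β γ δ E₀ k z x y x' w v₁ v v' e e' : ℂ}
    (hx : x ≠ x') (hz : z ≠ y) (hw : y ≠ w)
    (q₁ : energyNum α β γ δ z x = E₀ * (z * x)) (q₂ : energyNum α β γ δ x y = E₀ * (x * y))
    (q₃ : energyNum α β γ δ y x' = E₀ * (y * x')) (q₄ : energyNum α β γ δ x' w = E₀ * (x' * w))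
    (h₁ : (x - x') * (y - γ) * (y - δ) * v₁ - (z - y) * (x - γ) * (x - δ) * v = x * y * e)
    (h₂ : (y - w) * (x' - γ) * (x' - δ) * v - (x - x') * (y - γ) * (y - δ) * v' = y * x' * e')
    (he : (e - e') * (x * y * x') =
      γ * δ * k * (x - x') * (-(α + β) * y + 2 * α * β)) :
    v₁ * x' * ((y - γ) * (y - δ)) + x * v' * ((y - γ) * (y - δ))
        + x * x' * ((2 * y - γ - δ) * v) =
      γ * δ * ((v - α * k) * (y - β) + (y - α) * (v - β * k)) := by
  rw [energyNum_comm] at q₂ q₄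
  -- Vieta over x and over x' eliminates the outer points z and w.
  have r₁ := sum_of_energyNum_eq hz q₁ (by linear_combination q₂)
  have r₂ := sum_of_energyNum_eq hw q₃ (by linear_combination q₄)
  apply mul_left_cancel₀ (sub_ne_zero.mpr hx)
  linear_combination x' * h₁ - x * h₂ + he + v * x' * r₁ - v * x * r₂

/-- The variation of the energy numerator along the curve. -/
theorem energy_variation {α β γ δ E₀ z x y x' v₁ v e : ℂ} (hx : x ≠ x') (hz : z ≠ y)
    (q₁ : energyNum α β γ δ z x = E₀ * (z * x)) (q₂ : energyNum α β γ δ x y = E₀ * (x * y))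
    (q₃ : energyNum α β γ δ y x' = E₀ * (y * x'))
    (h₁ : (x - x') * (y - γ) * (y - δ) * v₁ - (z - y) * (x - γ) * (x - δ) * v = x * y * e) :
    2 * x * v₁ * y ^ 2 + x ^ 2 * (2 * y * v) - (γ + δ) * (x * v + v₁ * y) * (x + y)
        - (γ + δ) * (x * y) * (v₁ + v) + γ * δ * (2 * x * v₁ + 2 * y * v)
        - (α + β) * γ * δ * (v₁ + v) =
      E₀ * (x * v + v₁ * y) + e * (x * y) := by
  rw [energyNum_comm] at q₃
  -- `r₂` and `r₁` turn the partial derivatives at (x, y) into differences of the two roots.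
  have r₂ := sum_of_energyNum_eq hx q₂ (by linear_combination q₃)
  rw [energyNum_comm] at q₂
  have r₁ := sum_of_energyNum_eq hz q₁ (by linear_combination q₂)
  linear_combination h₁ + v * r₁ + v₁ * r₂

/-- The exponentials in c and d cancel against the scaling, and ξ₀ cancels in the products with ξ,
so only `kappa` still depends on η. -/
theorem scaled_equation {α β γ δ ξ₀ η : ℂ} (hξ₀ : ξ₀ ≠ 0) {D : Set ℂ} {w : ℂ → ℂ → ℂ}
    (h : IsSolution ξ₀ (α / ξ₀) (β / ξ₀) (Complex.exp (η - 1 / 2) * γ)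
      (Complex.exp (η - 1 / 2) * δ) η D (w η)) {m : ℂ} (h₁ : m - 1 ∈ D) (h₂ : m ∈ D)
    (h₃ : m + 1 ∈ D) :
    scaled w η (m + 1) * scaled w η (m - 1) * ((scaled w η m - γ) * (scaled w η m - δ)) =
      γ * δ * ((scaled w η m - α * kappa η m) * (scaled w η m - β * kappa η m)) := by
  have e := h.equation m h₁ h₂ h₃
  have hX : Complex.exp (1 / 2 - η) * Complex.exp (η - 1 / 2) = 1 := by
    rw [← Complex.exp_add]; simp
  have ha : ∀ a : ℂ, a / ξ₀ * xi ξ₀ η m = a * (1 + 1 / η) ^ (η ^ 2 + m) := fun a => by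
    unfold xi; field_simp
  rw [ha, ha] at e
  unfold scaled kappa
  set X := Complex.exp (1 / 2 - η)
  set Y := Complex.exp (η - 1 / 2)
  set K := (1 + 1 / η) ^ (η ^ 2 + m)
  have k : ∀ g : ℂ, X * w η m - g = X * (w η m - Y * g) := fun g => by
    linear_combination g * hX
  rw [k γ, k δ]
  linear_combination X ^ 4 * e + γ * δ * (X ^ 2) * (w η m - α * K) * (w η m - β * K)
    * (X * Y + 1) * hX

/-! ### One iteration of the equation, and the energy, to first order -/

/-- `u = U + v / η + O(η⁻²)` locally uniformly near `c`. -/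
abbrev Approx (l : Filter ℂ) (u : ℂ → ℂ → ℂ) (U v : ℂ → ℂ) (c : ℂ) : Prop :=
  FirstOrder (l ×ˢ 𝓝 c) (fun x => 1 / x.1) (fun x => u x.1 x.2) (fun x => U x.2)
    (fun x => v x.2)

theorem tendsto_shift (l : Filter ℂ) (c h : ℂ) :
    Tendsto (fun x : ℂ × ℂ => (x.1, x.2 + h)) (l ×ˢ 𝓝 c) (l ×ˢ 𝓝 (c + h)) :=
  tendsto_fst.prodMk (tendsto_snd.add_const h)

theorem tendsto_one_div_fst {l : Filter ℂ} (hl : l ≤ Bornology.cobounded ℂ) (c : ℂ) :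
    Tendsto (fun x : ℂ × ℂ => 1 / x.1) (l ×ˢ 𝓝 c) (𝓝 0) :=
  (tendsto_one_div hl).comp tendsto_fst

theorem isBigO_one_of_continuousAt {l : Filter ℂ} {f : ℂ → ℂ} {c : ℂ} (hf : ContinuousAt f c) :
    (fun x : ℂ × ℂ => f x.2) =O[l ×ˢ 𝓝 c] fun _ => (1 : ℂ) :=
  (hf.tendsto.comp tendsto_snd).isBigO_one ℂ

/-- One iteration of the equation. -/
theorem Approx.succ {α β γ δ c : ℂ} {l : Filter ℂ} (hl : l ≤ Bornology.cobounded ℂ)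
    {u : ℂ → ℂ → ℂ} {U v : ℂ → ℂ}
    (h' : Approx l u U v (c - 1)) (h : Approx l u U v c)
    (hU' : ContinuousAt U (c - 1)) (hUc : ContinuousAt U c) (hU₁ : ContinuousAt U (c + 1))
    (hv₁ : ContinuousAt v (c + 1)) (h0 : U (c - 1) ≠ 0) (hγ : U c - γ ≠ 0) (hδ : U c - δ ≠ 0)
    (hu : ∀ᶠ x in l ×ˢ 𝓝 c, u x.1 (x.2 + 1) * u x.1 (x.2 - 1) *
        ((u x.1 x.2 - γ) * (u x.1 x.2 - δ)) =
      γ * δ * ((u x.1 x.2 - α * kappa x.1 x.2) * (u x.1 x.2 - β * kappa x.1 x.2)))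
    (hUeq : ∀ᶠ m in 𝓝 c, U (m + 1) * U (m - 1) * ((U m - γ) * (U m - δ)) =
      γ * δ * (U m - α) * (U m - β))
    (hlin : ∀ᶠ m in 𝓝 c,
      v (m + 1) * U (m - 1) * ((U m - γ) * (U m - δ))
          + U (m + 1) * v (m - 1) * ((U m - γ) * (U m - δ))
          + U (m + 1) * U (m - 1) * ((2 * U m - γ - δ) * v m) =
        γ * δ * ((v m - α * (m + 1 / 3)) * (U m - β) + (U m - α) * (v m - β * (m + 1 / 3)))) :
    Approx l u U v (c + 1) := by
  have hε := tendsto_one_div_fst hl c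
  have hm : FirstOrder (l ×ˢ 𝓝 c) (fun x => 1 / x.1) (fun x => u x.1 (x.2 - 1))
      (fun x => U (x.2 - 1)) (fun x => v (x.2 - 1)) := by
    have := h'.comp (tendsto_shift l c (-1))
    simpa [← sub_eq_add_neg] using this
  have hc1 : ContinuousAt (fun m => U (m + 1)) c := ContinuousAt.comp' hU₁ (by fun_prop)
  have hcv : ContinuousAt (fun m => v (m + 1)) c := ContinuousAt.comp' hv₁ (by fun_prop)
  -- The candidate U + v/η at m + 1 is substituted into the equation. Its residual is O(η⁻²), and
  -- dividing by the cofactor of u_{m+1} bounds the error of the candidate.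
  have hp : FirstOrder (l ×ˢ 𝓝 c) (fun x => 1 / x.1)
      (fun x => U (x.2 + 1) + 1 / x.1 * v (x.2 + 1))
      (fun x => U (x.2 + 1)) (fun x => v (x.2 + 1)) :=
    ⟨isBigO_one_of_continuousAt hc1, isBigO_one_of_continuousAt hcv, by
      simpa using isBigO_zero _ _⟩
  have hG := (h.sub (.const γ)).mul hε (h.sub (.const δ))
  have hden := hm.mul hε hG
  have hk := kappa_firstOrder hl c
  have hrhs := ((h.sub (hk.const_mul hε α)).mul hε (h.sub (hk.const_mul hε β))).const_mul hε
    (γ * δ)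
  have hall := ((hp.mul hε hden).sub hrhs).remainder
  have hlim : Tendsto (fun x : ℂ × ℂ => u x.1 (x.2 - 1) * ((u x.1 x.2 - γ) * (u x.1 x.2 - δ)))
      (l ×ˢ 𝓝 c) (𝓝 (U (c - 1) * ((U c - γ) * (U c - δ)))) := by
    refine hden.tendsto hε ?_
    have hcm : ContinuousAt (fun m => U (m - 1)) c := ContinuousAt.comp' hU' (by fun_prop)
    have : ContinuousAt (fun m => U (m - 1) * ((U m - γ) * (U m - δ))) c :=
      hcm.mul
        ((hUc.sub continuousAt_const).mul (hUc.sub continuousAt_const))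
    exact this.tendsto.comp tendsto_snd
  have key : (fun x : ℂ × ℂ => u x.1 (x.2 + 1) - U (x.2 + 1) - 1 / x.1 * v (x.2 + 1))
      =O[l ×ˢ 𝓝 c] fun x => (1 / x.1) ^ 2 := by
    refine FirstOrder.isBigO_of_mul (mul_ne_zero h0 (mul_ne_zero hγ hδ)) hlim ?_
    refine hall.neg_left.congr' ?_ .rfl
    filter_upwards [hu, tendsto_snd.eventually hUeq, tendsto_snd.eventually hlin]
      with x hx hy hz
    linear_combination (-1 : ℂ) * hx + hy + 1 / x.1 * hz
  refine ⟨isBigO_one_of_continuousAt hU₁, isBigO_one_of_continuousAt hv₁, ?_⟩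
  have := key.comp_tendsto (by simpa using tendsto_shift l (c + 1) (-1))
  simpa [Function.comp_def] using this

/-- The energy of a solution to first order, near `c`. -/
theorem Approx.energy {α β γ δ E₀ c : ℂ} {l : Filter ℂ} (hl : l ≤ Bornology.cobounded ℂ)
    {u : ℂ → ℂ → ℂ} {U v e : ℂ → ℂ}
    (h : Approx l u U v c) (h₁ : Approx l u U v (c + 1))
    (hUc : ContinuousAt U c) (hU₁ : ContinuousAt U (c + 1)) (hec : ContinuousAt e c)
    (h0 : U c ≠ 0) (h1 : U (c + 1) ≠ 0)
    (hE : ∀ᶠ m in 𝓝 c, energyNum α β γ δ (U (m + 1)) (U m) = E₀ * (U (m + 1) * U m))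
    (hvar : ∀ᶠ m in 𝓝 c, 2 * U (m + 1) * v (m + 1) * U m ^ 2 + U (m + 1) ^ 2 * (2 * U m * v m)
        - (γ + δ) * (U (m + 1) * v m + v (m + 1) * U m) * (U (m + 1) + U m)
        - (γ + δ) * (U (m + 1) * U m) * (v (m + 1) + v m)
        + γ * δ * (2 * U (m + 1) * v (m + 1) + 2 * U m * v m)
        - (α + β) * γ * δ * (v (m + 1) + v m) =
      E₀ * (U (m + 1) * v m + v (m + 1) * U m) + e m * (U (m + 1) * U m)) :
    (fun x : ℂ × ℂ => QP3.energy α β γ δ (u x.1) x.2 - E₀ - 1 / x.1 * e x.2)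
      =O[l ×ˢ 𝓝 c] fun x => (1 / x.1) ^ 2 := by
  have hε := tendsto_one_div_fst hl c
  have hp := h₁.comp (tendsto_shift l c 1)
  dsimp only at hp
  have hxy := hp.mul hε h
  have hee : FirstOrder (l ×ˢ 𝓝 c) (fun x => 1 / x.1)
      (fun x => E₀ + 1 / x.1 * e x.2) (fun _ => E₀) (fun x => e x.2) :=
    ⟨isBigO_const_const _ one_ne_zero _, isBigO_one_of_continuousAt hec, by
      simpa using isBigO_zero _ _⟩
  have hN := ((((hxy.mul hε hxy).sub ((hxy.mul hε (hp.add h)).const_mul hε (γ + δ))).add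
    (((hp.mul hε hp).add (h.mul hε h)).const_mul hε (γ * δ))).sub
    ((hp.add h).const_mul hε ((α + β) * γ * δ))).add (.const (α * β * γ * δ))
  have hall := (hN.sub (hee.mul hε hxy)).remainder
  have hlim : Tendsto (fun x : ℂ × ℂ => u x.1 (x.2 + 1) * u x.1 x.2)
      (l ×ˢ 𝓝 c) (𝓝 (U (c + 1) * U c)) := by
    refine hxy.tendsto hε ?_
    have hcp : ContinuousAt (fun m => U (m + 1)) c := ContinuousAt.comp' hU₁ (by fun_prop)
    have : ContinuousAt (fun m => U (m + 1) * U m) c :=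
      hcp.mul hUc
    exact this.tendsto.comp tendsto_snd
  refine FirstOrder.isBigO_of_mul (mul_ne_zero h1 h0) hlim (hall.congr' ?_ .rfl)
  filter_upwards [tendsto_snd.eventually hE, tendsto_snd.eventually hvar,
    hlim.eventually_ne (mul_ne_zero h1 h0)] with x hx hy hz
  unfold QP3.energy
  rw [sub_mul, sub_mul, div_mul_cancel₀ _ hz]
  unfold energyNum at hx ⊢
  linear_combination (-1 : ℂ) * hx - 1 / x.1 * hy

/-! ### Return points near a period -/

section ApproximatePeriod

variable {l : Filter ℂ} {u : ℂ → ℂ → ℂ} {U v : ℂ → ℂ} {c : ℂ} {D : Set ℂ}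

theorem Approx.isBigO_sub (hl : l ≤ Bornology.cobounded ℂ) (h : Approx l u U v c) :
    (fun x : ℂ × ℂ => u x.1 x.2 - U x.2) =O[l ×ˢ 𝓝 c] fun x => 1 / x.1 :=
  FirstOrder.sub_isBigO (tendsto_one_div_fst hl c) h

theorem tendsto_prodMk {Z : ℂ → ℂ} (hZ : Tendsto Z l (𝓝 c)) :
    Tendsto (fun η => (η, Z η)) l (l ×ˢ 𝓝 c) :=
  tendsto_id.prodMk hZ

/-- The correction `u - U` is Lipschitz near `c` with a constant of order `1 / η`. -/
theorem Approx.exists_lipschitz (hl : l ≤ Bornology.cobounded ℂ) (h : Approx l u U v c)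
    (hU : AnalyticAt ℂ U c) (hD : IsOpen D) (hc : c ∈ D)
    (hu : ∀ᶠ η in l, DifferentiableOn ℂ (u η) D) :
    ∃ r > 0, ∃ C : ℝ, ∀ᶠ η in l, ∀ z ∈ Metric.ball c r, ∀ z' ∈ Metric.ball c r,
      ‖(u η z - U z) - (u η z' - U z')‖ ≤ C * ‖1 / η‖ * ‖z - z'‖ := by
  obtain ⟨C, hC⟩ := (h.isBigO_sub hl).bound
  obtain ⟨t₁, ht₁, t₂, ht₂, ht⟩ := mem_prod_iff.mp hC
  obtain ⟨ρ, hρ, hball⟩ := Metric.mem_nhds_iff.mp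
    (inter_mem (inter_mem ht₂ (hD.mem_nhds hc)) hU.eventually_analyticAt)
  refine ⟨ρ / 2, half_pos hρ, C / (ρ / 4), ?_⟩
  filter_upwards [ht₁, hu] with η hη hd z hz z' hz'
  have hs : DifferentiableOn ℂ (fun z => u η z - U z) (Metric.ball c ρ) := fun y hy =>
    ((hd.differentiableAt (hD.mem_nhds (hball hy).1.2)).sub
      (hball hy).2.differentiableAt).differentiableWithinAt
  have hsub : ∀ y ∈ Metric.ball c (ρ / 2), Metric.closedBall y (ρ / 4) ⊆ Metric.ball c ρ := by
    intro y hy x hx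
    rw [Metric.mem_ball, Metric.mem_closedBall] at *
    have := dist_triangle x y c
    linarith
  -- Cauchy's estimate on circles of radius ρ/4, which stay inside the ball where u - U is O(1/η).
  have hder : ∀ y ∈ Metric.ball c (ρ / 2),
      ‖deriv (fun z => u η z - U z) y‖ ≤ C / (ρ / 4) * ‖1 / η‖ := by
    intro y hy
    have := Complex.norm_deriv_le_of_forall_mem_sphere_norm_le (by positivity : 0 < ρ / 4)
      (hs.diffContOnCl_ball (hsub y hy)) (C := C * ‖1 / η‖) fun x hx =>
        ht (Set.mk_mem_prod hη (hball (hsub y hy (Metric.sphere_subset_closedBall hx))).1.1)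
    exact this.trans_eq (by ring)
  exact (convex_ball c (ρ / 2)).norm_image_sub_le_of_norm_deriv_le
    (fun y hy => hs.differentiableAt (Metric.isOpen_ball.mem_nhds
      (Metric.ball_subset_ball (by linarith) hy))) hder hz' hz

/-- `U'(c)` is a strict derivative of `u`, uniformly along `l`. -/
theorem Approx.exists_approximates (hl : l ≤ Bornology.cobounded ℂ) (h : Approx l u U v c)
    (hU : AnalyticAt ℂ U c) (hD : IsOpen D) (hc : c ∈ D)
    (hu : ∀ᶠ η in l, DifferentiableOn ℂ (u η) D) {k : ℝ} (hk : 0 < k) :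
    ∃ r > 0, Metric.ball c r ⊆ D ∧ ∀ᶠ η in l, ∀ z ∈ Metric.ball c r, ∀ z' ∈ Metric.ball c r,
      ‖u η z - u η z' - deriv U c * (z - z')‖ ≤ k * ‖z - z'‖ := by
  obtain ⟨r, hr, C, hC⟩ := h.exists_lipschitz hl hU hD hc hu
  have hstrict := hU.hasStrictDerivAt.hasStrictFDerivAt.isLittleO.bound (half_pos hk)
  rw [nhds_prod_eq] at hstrict
  obtain ⟨t, ht, hts⟩ := mem_prod_same_iff.mp hstrict
  obtain ⟨ρ, hρ, hball⟩ := Metric.mem_nhds_iff.mp (inter_mem ht (hD.mem_nhds hc))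
  have hsmall : ∀ᶠ η in l, C * ‖1 / η‖ < k / 2 := by
    have : Tendsto (fun η : ℂ => C * ‖1 / η‖) l (𝓝 (C * ‖(0 : ℂ)‖)) :=
      ((tendsto_one_div hl).norm).const_mul C
    exact this.eventually_lt_const (by simpa using half_pos hk)
  refine ⟨min r ρ, lt_min hr hρ,
    fun z hz => (hball (Metric.ball_subset_ball (min_le_right _ _) hz)).2, ?_⟩
  filter_upwards [hC, hsmall] with η h₁ h₂ z hz z' hz'
  have hr' := Metric.ball_subset_ball (x := c) (min_le_left r ρ)
  have hρ' := Metric.ball_subset_ball (x := c) (min_le_right r ρ)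
  have e₁ := h₁ z (hr' hz) z' (hr' hz')
  have e₂ : ‖U z - U z' - (z - z') • deriv U c‖ ≤ k / 2 * ‖z - z'‖ :=
    by simpa using hts (Set.mk_mem_prod (hball (hρ' hz)).1 (hball (hρ' hz')).1)
  calc ‖u η z - u η z' - deriv U c * (z - z')‖
      = ‖((u η z - U z) - (u η z' - U z')) + (U z - U z' - (z - z') • deriv U c)‖ := by
        congr 1; simp only [smul_eq_mul]; ring
    _ ≤ C * ‖1 / η‖ * ‖z - z'‖ + k / 2 * ‖z - z'‖ := norm_add_le_of_le e₁ e₂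
    _ ≤ k / 2 * ‖z - z'‖ + k / 2 * ‖z - z'‖ := by gcongr
    _ = k * ‖z - z'‖ := by ring

theorem Approx.isBigO_at (hl : l ≤ Bornology.cobounded ℂ) (h : Approx l u U v c) :
    (fun η => u η c - U c) =O[l] fun η => 1 / η :=
  (h.isBigO_sub hl).comp_tendsto (tendsto_prodMk tendsto_const_nhds)

/-- Near `c`, the solution attains the value `U c`. -/
theorem Approx.exists_return (hl : l ≤ Bornology.cobounded ℂ) (h : Approx l u U v c)
    (hU : AnalyticAt ℂ U c) (hU' : deriv U c ≠ 0) (hD : IsOpen D) (hc : c ∈ D)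
    (hu : ∀ᶠ η in l, DifferentiableOn ℂ (u η) D) :
    ∃ Z : ℂ → ℂ, (∀ᶠ η in l, u η (Z η) = U c) ∧ Tendsto Z l (𝓝 c) := by
  classical
  have hpos : 0 < ‖deriv U c‖ := norm_pos_iff.mpr hU'
  obtain ⟨r, hr, hrD, hap⟩ := h.exists_approximates hl hU hD hc hu (half_pos hpos)
  have hs0 : Tendsto (fun η => u η c - U c) l (𝓝 0) :=
    (h.isBigO_at hl).trans_tendsto (tendsto_one_div hl)
  have hlow : ∀ᶠ η in l, ∀ z ∈ Metric.ball c r,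
      ‖deriv U c‖ / 2 * ‖z - c‖ ≤ ‖u η z - u η c‖ := by
    filter_upwards [hap] with η h₁ z hz
    have h₂ := h₁ z hz c (Metric.mem_ball_self hr)
    have h₃ := norm_sub_norm_le (deriv U c * (z - c)) (deriv U c * (z - c) - (u η z - u η c))
    rw [norm_sub_rev (deriv U c * (z - c)) (u η z - u η c), norm_mul] at h₃
    rw [show deriv U c * (z - c) - (deriv U c * (z - c) - (u η z - u η c)) = u η z - u η c by
      ring] at h₃
    linarith
  have hex : ∀ᶠ η in l, ∃ z ∈ Metric.ball c r, u η z = U c := by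
    -- The quantitative open mapping theorem covers a ball of half the lower bound on the circle of
    -- radius r/2; hence the final division by 2.
    have hsm : ∀ᶠ η in l, ‖u η c - U c‖ < ‖deriv U c‖ / 2 * (r / 2) / 2 :=
      (hs0.norm).eventually_lt_const (by rw [norm_zero]; positivity)
    filter_upwards [hlow, hsm, hu] with η h₁ h₂ h₃
    have hcl : Metric.closedBall c (r / 2) ⊆ Metric.ball c r :=
      Metric.closedBall_subset_ball (by linarith)
    have himg := ((h₃.mono hrD).diffContOnCl_ball hcl).ball_subset_image_closedBall
      (half_pos hr) (ε := ‖deriv U c‖ / 2 * (r / 2)) (fun z hz => by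
        have := h₁ z (hcl (Metric.sphere_subset_closedBall hz))
        rwa [mem_sphere_iff_norm.mp hz] at this) (by
        have hne : ∀ᶠ z in 𝓝[≠] c, u η z ≠ u η c := by
          filter_upwards [self_mem_nhdsWithin,
            mem_nhdsWithin_of_mem_nhds (Metric.ball_mem_nhds c hr)] with z hz hzr he
          have := h₁ z hzr
          rw [he, sub_self, norm_zero] at this
          have : 0 < ‖z - c‖ := norm_pos_iff.mpr (sub_ne_zero.mpr hz)
          nlinarith
        exact hne.frequently.filter_mono nhdsWithin_le_nhds)
    obtain ⟨z, hz, hzU⟩ := himg (show U c ∈ _ by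
      rw [Metric.mem_ball, dist_comm, dist_eq_norm]; exact h₂)
    exact ⟨z, hcl hz, hzU⟩
  refine ⟨fun η => if hη : ∃ z ∈ Metric.ball c r, u η z = U c then hη.choose else c, ?_, ?_⟩
  · filter_upwards [hex] with η hη
    rw [dif_pos hη]
    exact hη.choose_spec.2
  · rw [tendsto_iff_norm_sub_tendsto_zero]
    have hlim : Tendsto (fun η => 2 / ‖deriv U c‖ * ‖u η c - U c‖) l (𝓝 0) := by
      simpa using hs0.norm.const_mul (2 / ‖deriv U c‖)
    refine squeeze_zero' (.of_forall fun _ => norm_nonneg _) ?_ hlim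
    filter_upwards [hex, hlow] with η hη h₁
    rw [dif_pos hη]
    have h₂ := h₁ _ hη.choose_spec.1
    rw [hη.choose_spec.2, norm_sub_rev (U c)] at h₂
    rw [div_mul_eq_mul_div, le_div_iff₀ hpos]
    linarith

variable {Z : ℂ → ℂ}

/-- At a return point, u(Z) - u(c) = -(u(c) - U(c)), while the uniform strict derivative compares
the left side with U'(c)(Z - c) up to any prescribed relative error. -/
theorem Approx.return_isEquivalent (hl : l ≤ Bornology.cobounded ℂ) (h : Approx l u U v c)
    (hU : AnalyticAt ℂ U c) (hD : IsOpen D) (hc : c ∈ D)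
    (hu : ∀ᶠ η in l, DifferentiableOn ℂ (u η) D) (hU' : deriv U c ≠ 0)
    (hZ : Tendsto Z l (𝓝 c)) (hret : ∀ᶠ η in l, u η (Z η) = U c) :
    (fun η => -(u η c - U c)) ~[l] fun η => deriv U c * (Z η - c) := by
  refine IsLittleO.of_bound fun k hk => ?_
  have hpos : 0 < ‖deriv U c‖ := norm_pos_iff.mpr hU'
  obtain ⟨r, hr, -, hap⟩ := h.exists_approximates hl hU hD hc hu (mul_pos hk hpos)
  filter_upwards [hap, hret, hZ (Metric.ball_mem_nhds c hr)] with η h₁ h₂ h₃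
  have := h₁ _ h₃ c (Metric.mem_ball_self hr)
  rw [h₂] at this
  simp only [Pi.sub_apply, norm_mul]
  calc _ = _ := by congr 1; ring
    _ ≤ _ := this
    _ = _ := by ring

/-- The return point in terms of the correction `u - U`. -/
theorem Approx.return_isLittleO (hl : l ≤ Bornology.cobounded ℂ) (h : Approx l u U v c)
    (hU : AnalyticAt ℂ U c) (hD : IsOpen D) (hc : c ∈ D)
    (hu : ∀ᶠ η in l, DifferentiableOn ℂ (u η) D) (hU' : deriv U c ≠ 0)
    (hZ : Tendsto Z l (𝓝 c)) (hret : ∀ᶠ η in l, u η (Z η) = U c) :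
    (fun η => Z η - (c - (u η c - U c) / deriv U c)) =o[l] fun η => u η c - U c := by
  have hq := (h.return_isEquivalent hl hU hD hc hu hU' hZ hret).symm.isLittleO
  refine ((hq.const_mul_left (deriv U c)⁻¹).neg_right.congr (fun η => ?_) fun η => ?_)
  · simp only [Pi.sub_apply]; field_simp; ring
  · ring

theorem Approx.return_isBigO (hl : l ≤ Bornology.cobounded ℂ) (h : Approx l u U v c)
    (hU : AnalyticAt ℂ U c) (hD : IsOpen D) (hc : c ∈ D)
    (hu : ∀ᶠ η in l, DifferentiableOn ℂ (u η) D) (hU' : deriv U c ≠ 0)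
    (hZ : Tendsto Z l (𝓝 c)) (hret : ∀ᶠ η in l, u η (Z η) = U c) :
    (fun η => Z η - c) =O[l] fun η => 1 / η := by
  have hq := (h.return_isEquivalent hl hU hD hc hu hU' hZ hret).isBigO_symm
  refine ((hq.const_mul_left (deriv U c)⁻¹).congr_left fun η => ?_).trans
    (h.isBigO_at hl).neg_left
  field_simp

/-- The return point in terms of the first-order correction. -/
theorem Approx.return_firstOrder (hl : l ≤ Bornology.cobounded ℂ) (h : Approx l u U v c)
    (hU : AnalyticAt ℂ U c) (hD : IsOpen D) (hc : c ∈ D)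
    (hu : ∀ᶠ η in l, DifferentiableOn ℂ (u η) D) (hU' : deriv U c ≠ 0)
    (hZ : Tendsto Z l (𝓝 c)) (hret : ∀ᶠ η in l, u η (Z η) = U c) :
    (fun η => Z η - (c - 1 / η * v c / deriv U c)) =O[l] fun η => (1 / η) ^ 2 := by
  have hO := h.return_isBigO hl hU hD hc hu hU' hZ hret
  obtain ⟨r, hr, C, hC⟩ := h.exists_lipschitz hl hU hD hc hu
  -- The Lipschitz constant and the displacement Z - c are both O(1/η).
  have hs : (fun η => (u η (Z η) - U (Z η)) - (u η c - U c)) =O[l] fun η => (1 / η) ^ 2 := by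
    have : (fun η => (u η (Z η) - U (Z η)) - (u η c - U c)) =O[l]
        fun η => 1 / η * (Z η - c) := by
      refine IsBigO.of_bound C ?_
      filter_upwards [hC, hZ (Metric.ball_mem_nhds c hr)] with η h₁ h₂
      rw [norm_mul, ← mul_assoc]
      exact h₁ _ h₂ c (Metric.mem_ball_self hr)
    refine this.trans ?_
    simpa only [sq] using (isBigO_refl (fun η : ℂ => 1 / η) l).mul hO
  have hd : (fun η => U (Z η) - U c - deriv U c * (Z η - c)) =O[l] fun η => (1 / η) ^ 2 := by
    obtain ⟨p, hp⟩ := hU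
    -- The Taylor remainder is Z - c times the increment of the difference quotient `dslope`, itself
    -- analytic at c.
    have h₁ := hp.has_fpower_series_dslope_fslope.differentiableAt.isBigO_sub.comp_tendsto hZ
    have h₂ := hO.mul (h₁.trans hO)
    simp only [← sq] at h₂
    refine h₂.congr_left fun η => ?_
    simp only [Function.comp_def]
    rw [dslope_same, mul_sub, ← smul_eq_mul, sub_smul_dslope]
    ring
  have hr' : (fun η => u η c - U c - 1 / η * v c) =O[l] fun η => (1 / η) ^ 2 :=
    FirstOrder.remainder h |>.comp_tendsto (tendsto_prodMk tendsto_const_nhds)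
  refine (((hs.add hd).add hr').const_mul_left (-(deriv U c)⁻¹)).congr' ?_ .rfl
  filter_upwards [hret] with η hη
  rw [hη]
  field_simp
  ring

end ApproximatePeriod

/-! ### The explicit first-order correction and its energy -/

theorem isOpen_iterates {D₀ : Set ℂ} (h : IsOpen D₀) (M : ℕ) : IsOpen (iterates D₀ M) := by
  have : iterates D₀ M = ⋃ j : ℕ, ⋃ _ : j ≤ M, (fun m : ℂ => m - j) ⁻¹' D₀ := by
    ext m; simp [iterates]
  rw [this]
  exact isOpen_iUnion fun j => isOpen_iUnion fun _ => h.preimage (by fun_prop)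

section FirstOrderSolution

variable {α β γ δ φ : ℂ} {ω : Fin 2 → ℂ} {U A B T : ℂ → ℂ} {D : Set ℂ}

theorem IsRegularOn.continuousAt_F (hreg : IsRegularOn γ δ U D) {c : ℂ} (hc : c ∈ D) :
    ContinuousAt (F γ δ U) c := by
  obtain ⟨h₁, h₂, h₃, -, -⟩ := hreg c hc
  have k₁ : ContinuousAt (fun m => U (m - 1)) c :=
    ContinuousAt.comp' h₁.continuousAt (by fun_prop)
  have k₃ : ContinuousAt (fun m => U (m + 1)) c :=
    ContinuousAt.comp' h₃.continuousAt (by fun_prop)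
  exact ((k₃.sub k₁).mul (h₂.continuousAt.sub continuousAt_const)).mul
    (h₂.continuousAt.sub continuousAt_const)

theorem IsRegularOn.continuousAt_F_mul (hreg : IsRegularOn γ δ U D) {f : ℂ → ℂ}
    (hT : IsSum φ D f T) {c : ℂ} (hc : c ∈ D) :
    ContinuousAt (fun m => F γ δ U m * T m) c :=
  (hreg.continuousAt_F hc).mul (hT.analytic c hc).continuousAt

/-- The outer sum telescopes: dividing by F_{c+1} F_c leaves T_{c+1} - T_c, the summand. This is the
first-order variation of the energy for v = F T. -/
theorem IsRegularOn.energy_relation (hreg : IsRegularOn γ δ U D)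
    (hT : IsSum φ D (nestedTerm α β γ δ φ U A B) T) {c : ℂ} (hc : c ∈ D) (hc₁ : c + 1 ∈ D) :
    F γ δ U c * (F γ δ U (c + 1) * T (c + 1)) - F γ δ U (c + 1) * (F γ δ U c * T c) =
      U (c + 1) * U c * energyCoeff α β γ δ φ U A B c := by
  obtain ⟨-, -, -, h0, hF⟩ := hreg c hc
  obtain ⟨-, -, -, h1, hF₁⟩ := hreg _ hc₁
  rw [← nestedTerm_mul h1 h0 hF₁ hF, hT.step c hc hc₁]
  ring

theorem F_ne_zero_iff {c : ℂ} : F γ δ U c ≠ 0 ↔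
    U (c + 1) ≠ U (c - 1) ∧ U c - γ ≠ 0 ∧ U c - δ ≠ 0 := by
  simp [F, sub_ne_zero, and_assoc]

/-- The first-order correction solves the linearised equation. -/
theorem IsLeadingOrder.linearized (hU : IsLeadingOrder α β γ δ ω U)
    (hreg : IsRegularOn γ δ U D) (hA : IsSum φ D (sumTerm U) A) (hB : IsSum φ D (prodTerm U) B)
    (hT : IsSum φ D (nestedTerm α β γ δ φ U A B) T) {m : ℂ} (h' : m - 1 ∈ D) (h : m ∈ D)
    (h₁ : m + 1 ∈ D) :
    F γ δ U (m + 1) * T (m + 1) * U (m - 1) * ((U m - γ) * (U m - δ))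
        + U (m + 1) * (F γ δ U (m - 1) * T (m - 1)) * ((U m - γ) * (U m - δ))
        + U (m + 1) * U (m - 1) * ((2 * U m - γ - δ) * (F γ δ U m * T m)) =
      γ * δ * ((F γ δ U m * T m - α * (m + 1 / 3)) * (U m - β)
        + (U m - α) * (F γ δ U m * T m - β * (m + 1 / 3))) := by
  obtain ⟨E₀, hE⟩ := hU.invariant
  obtain ⟨a₁, a₂, a₃, n₁, f₁⟩ := hreg _ h'
  obtain ⟨-, -, b₃, n₂, f₂⟩ := hreg _ h
  obtain ⟨-, -, d₃, n₃, f₃⟩ := hreg _ h₁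
  have r₁ := hreg.energy_relation hT h h₁
  have r₂ := hreg.energy_relation hT h' (by rwa [sub_add_cancel])
  have he := energyCoeff_sub (α := α) (β := β) (γ := γ) (δ := δ) (φ := φ) n₃ n₂ n₁
    (hA.step m h h₁) (hB.step m h h₁)
  -- F at m ± 1 reaches U at m ± 2, so four consecutive points of the curve enter.
  have q₄ := hE (m - 1 - 1) a₁ (by rwa [sub_add_cancel])
  have q₃ := hE (m - 1) a₂ a₃
  rw [sub_add_cancel] at q₃ q₄ r₂
  have hF : ∀ c, F γ δ U c = (U (c + 1) - U (c - 1)) * (U c - γ) * (U c - δ) := fun _ => rfl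
  have e₁ := hF (m - 1)
  have e₃ := hF (m + 1)
  rw [sub_add_cancel] at e₁
  rw [add_sub_cancel_right] at e₃
  have g₁ := (F_ne_zero_iff.mp f₁).1
  have g₃ := (F_ne_zero_iff.mp f₃).1
  rw [sub_add_cancel] at g₁
  rw [add_sub_cancel_right] at g₃
  refine linearized_of_energy (F_ne_zero_iff.mp f₂).1 g₃ g₁ (hE (m + 1) b₃ d₃)
    (hE m (by simpa using a₃) b₃) q₃ q₄
    (e := energyCoeff α β γ δ φ U A B m) (e' := energyCoeff α β γ δ φ U A B (m - 1)) ?_ ?_ ?_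
  · rw [← e₃, ← hF, r₁]
  · rw [← e₁, ← hF]; linear_combination r₂
  · rw [he]

theorem energyCoeff_continuousAt (hreg : IsRegularOn γ δ U D)
    (hA : IsSum φ D (sumTerm U) A) (hB : IsSum φ D (prodTerm U) B) {c : ℂ} (h : c ∈ D)
    (h₁ : c + 1 ∈ D) : ContinuousAt (energyCoeff α β γ δ φ U A B) c := by
  obtain ⟨-, k, k', n, -⟩ := hreg c h
  obtain ⟨-, -, -, n', -⟩ := hreg _ h₁
  have k₀ := k.continuousAt
  have k₁ : ContinuousAt (fun m => U (m + 1)) c :=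
    ContinuousAt.comp' k'.continuousAt (by fun_prop)
  have kA : ContinuousAt (fun m => A (m + 1)) c :=
    ContinuousAt.comp' (hA.analytic _ h₁).continuousAt (by fun_prop)
  have kB : ContinuousAt (fun m => B (m + 1)) c :=
    ContinuousAt.comp' (hB.analytic _ h₁).continuousAt (by fun_prop)
  have i₀ : ContinuousAt (fun m => 1 / U m) c := continuousAt_const.div k₀ n
  have i₁ : ContinuousAt (fun m => 1 / U (m + 1)) c := continuousAt_const.div k₁ n'
  have i₂ : ContinuousAt (fun m => (3 * m + 4) / (U (m + 1) * U m)) c :=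
    ContinuousAt.div (by fun_prop) (k₁.mul k₀) (mul_ne_zero n' n)
  have i₃ : ContinuousAt (fun m : ℂ => 3 * m + 4) c := by fun_prop
  exact (((continuousAt_const.add (continuousAt_const.mul (i₃.mul (i₁.add i₀)))).sub
    (continuousAt_const.mul i₂)).add (continuousAt_const.mul kB)).sub (continuousAt_const.mul kA)

/-- The first-order energy at `l`; the last two terms compare `U` at `l` and at `φ`. -/
theorem energyCoeff_eq (hA : IsSum φ D (sumTerm U) A) (hB : IsSum φ D (prodTerm U) B)
    (h : φ ∈ D) (h₁ : φ + 1 ∈ D) (l : ℂ) :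
    energyCoeff α β γ δ φ U A B l =
      (α + β) * γ * δ * ((1 / U (φ + 1) + 1 / U φ) * (l - φ) - (A (l + 1) - A (φ + 1)))
        - 2 * α * β * γ * δ * ((l - φ) / (U (φ + 1) * U φ))
        + 2 * α * β * γ * δ * (B (l + 1) - B (φ + 1))
        + (α + β) * γ * δ * ((l + 4 / 3) *
          (1 / U (l + 1) + 1 / U l - (1 / U (φ + 1) + 1 / U φ)))
        - 2 * α * β * γ * δ * ((l + 4 / 3) *
          (1 / (U (l + 1) * U l) - 1 / (U (φ + 1) * U φ))) := by
  rw [hA.step φ h h₁, hB.step φ h h₁, hA.base, hB.base]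
  unfold energyCoeff e₁ sumTerm prodTerm
  simp only [div_eq_mul_inv, mul_inv]
  ring

/-- Propagation of the first-order expansion to all the iterates. -/
theorem IsLeadingOrder.approx_iterates (hU : IsLeadingOrder α β γ δ ω U) {D₀ : Set ℂ}
    (hD₀ : IsOpen D₀) {M : ℕ} (hreg : IsRegularOn γ δ U (iterates D₀ M))
    (hA : IsSum φ (iterates D₀ M) (sumTerm U) A) (hB : IsSum φ (iterates D₀ M) (prodTerm U) B)
    (hT : IsSum φ (iterates D₀ M) (nestedTerm α β γ δ φ U A B) T)
    {l : Filter ℂ} (hl : l ≤ Bornology.cobounded ℂ) {u : ℂ → ℂ → ℂ}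
    (hu : ∀ᶠ η in l, ∀ m, m - 1 ∈ iterates D₀ M → m ∈ iterates D₀ M → m + 1 ∈ iterates D₀ M →
      u η (m + 1) * u η (m - 1) * ((u η m - γ) * (u η m - δ)) =
        γ * δ * ((u η m - α * kappa η m) * (u η m - β * kappa η m)))
    (h₁ : ∀ m ∈ iterates D₀ M, m ∈ iterates D₀ 1 →
      Approx l u U (fun m => F γ δ U m * T m) m) {m : ℂ} (hm : m ∈ iterates D₀ M) :
    Approx l u U (fun m => F γ δ U m * T m) m := by
  obtain ⟨j, hj, hm⟩ := hm
  induction j using Nat.strong_induction_on generalizing m with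
  | _ j ih =>
    rcases Nat.lt_or_ge j 2 with hj2 | hj2
    -- The equation is second-order, so D₀ and D₀ + 1 are both base cases, supplied by the initial
    -- functions.
    · exact h₁ m ⟨j, hj, hm⟩ ⟨j, by omega, hm⟩
    · obtain ⟨i, rfl⟩ := Nat.exists_eq_add_of_le' hj2
      obtain ⟨c, rfl⟩ : ∃ c, m = c + 1 := ⟨m - 1, by ring⟩
      have m' : c - 1 - (i : ℂ) ∈ D₀ := by
        convert hm using 1; push_cast; ring
      have mc : c - ((i + 1 : ℕ) : ℂ) ∈ D₀ := by
        convert hm using 1; push_cast; ring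
      have hc' : c - 1 ∈ iterates D₀ M := ⟨i, by omega, m'⟩
      have hc : c ∈ iterates D₀ M := ⟨i + 1, by omega, mc⟩
      have hc₁ : c + 1 ∈ iterates D₀ M := ⟨i + 2, hj, hm⟩
      have hev : ∀ᶠ m in 𝓝 c, m - 1 ∈ iterates D₀ M ∧ m ∈ iterates D₀ M ∧
          m + 1 ∈ iterates D₀ M := by
        have hO := isOpen_iterates hD₀ M
        have k' : ContinuousAt (fun m : ℂ => m - 1) c := by fun_prop
        have k₁ : ContinuousAt (fun m : ℂ => m + 1) c := by fun_prop
        exact (k'.eventually (hO.mem_nhds hc')).and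
          ((hO.eventually_mem hc).and (k₁.eventually (hO.mem_nhds hc₁)))
      obtain ⟨-, a, -, n, -⟩ := hreg _ hc'
      obtain ⟨-, b, b', -, f⟩ := hreg _ hc
      refine Approx.succ (α := α) (β := β) hl (ih i (by omega) (by omega) m')
        (ih (i + 1) (by omega) (by omega) mc)
        a.continuousAt b.continuousAt b'.continuousAt (hreg.continuousAt_F_mul hT hc₁) n
        (F_ne_zero_iff.mp f).2.1 (F_ne_zero_iff.mp f).2.2 ?_ ?_ ?_
      · filter_upwards [tendsto_fst.eventually hu, tendsto_snd.eventually hev] with x hx hy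
        exact hx x.2 hy.1 hy.2.1 hy.2.2
      · filter_upwards [hev] with m hm
        obtain ⟨p, q, r, -, -⟩ := hreg m hm.2.1
        exact hU.equation m p q r
      · filter_upwards [hev] with m hm
        exact hU.linearized hreg hA hB hT hm.1 hm.2.1 hm.2.2

/-- The energy of the solution to first order. -/
theorem IsLeadingOrder.energy_isBigO (hU : IsLeadingOrder α β γ δ ω U) (hD : IsOpen D)
    (hreg : IsRegularOn γ δ U D)
    (hA : IsSum φ D (sumTerm U) A) (hB : IsSum φ D (prodTerm U) B)
    (hT : IsSum φ D (nestedTerm α β γ δ φ U A B) T)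
    {l : Filter ℂ} (hl : l ≤ Bornology.cobounded ℂ) {u : ℂ → ℂ → ℂ} {c : ℂ}
    (hc : c ∈ D) (hc₁ : c + 1 ∈ D)
    (h : Approx l u U (fun m => F γ δ U m * T m) c)
    (h₁ : Approx l u U (fun m => F γ δ U m * T m) (c + 1)) (hφ : φ ∈ D) (hφ₁ : φ + 1 ∈ D) :
    (fun x : ℂ × ℂ => QP3.energy α β γ δ (u x.1) x.2 - QP3.energy α β γ δ U φ
        - 1 / x.1 * energyCoeff α β γ δ φ U A B x.2)
      =O[l ×ˢ 𝓝 c] fun x => (1 / x.1) ^ 2 := by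
  obtain ⟨E₀, hE⟩ := hU.invariant
  obtain ⟨-, a, b, n, f⟩ := hreg c hc
  obtain ⟨-, -, d, n', f'⟩ := hreg _ hc₁
  have hev : ∀ᶠ m in 𝓝 c, m ∈ D ∧ m + 1 ∈ D := by
    have k₁ : ContinuousAt (fun m : ℂ => m + 1) c := by fun_prop
    exact (hD.eventually_mem hc).and (k₁.eventually (hD.mem_nhds hc₁))
  have hE₀ : QP3.energy α β γ δ U φ = E₀ := by
    obtain ⟨-, a, b, n, -⟩ := hreg φ hφ
    obtain ⟨-, -, -, n', -⟩ := hreg _ hφ₁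
    rw [QP3.energy, hE φ a b, mul_div_cancel_right₀ _ (mul_ne_zero n' n)]
  rw [hE₀]
  refine Approx.energy hl h h₁ a.continuousAt b.continuousAt
    (energyCoeff_continuousAt hreg hA hB hc hc₁) n n' ?_ ?_
  · filter_upwards [hev] with m hm
    obtain ⟨-, a, b, -, -⟩ := hreg m hm.1
    exact hE m a b
  · filter_upwards [hev] with m hm
    obtain ⟨a', a, b, -, f⟩ := hreg m hm.1
    obtain ⟨-, -, d, -, f'⟩ := hreg _ hm.2
    have q₃ := hE (m - 1) a' (by simpa using a)
    have g := (F_ne_zero_iff.mp f').1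
    have hF : ∀ c, F γ δ U c = (U (c + 1) - U (c - 1)) * (U c - γ) * (U c - δ) := fun _ => rfl
    have e₁ := hF (m + 1)
    rw [sub_add_cancel] at q₃
    rw [add_sub_cancel_right] at g e₁
    refine energy_variation (F_ne_zero_iff.mp f).1 g (hE (m + 1) b d) (hE m a b) q₃ ?_
    rw [← e₁, ← hF, hreg.energy_relation hT hm.1 hm.2]

/-- The change of the energy over an approximate period. -/
theorem energy_change_isBigO (hreg : IsRegularOn γ δ U D)
    (hA : IsSum φ D (sumTerm U) A) (hB : IsSum φ D (prodTerm U) B)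
    {l : Filter ℂ} {τ : ℂ} (hper : Function.Periodic U τ)
    (hτ : φ + τ ∈ D) (hφ : φ ∈ D) (hφ₁ : φ + 1 ∈ D)
    {Ω : ℂ → ℂ} (hΩ : Tendsto Ω l (𝓝 τ)) (hΩO : (fun η => Ω η - τ) =O[l] fun η => 1 / η) :
    (fun η => 1 / η * energyCoeff α β γ δ φ U A B (φ + Ω η)
      - ((α + β) * γ * δ / η *
            ((1 / U (φ + 1) + 1 / U φ) * τ - (A (φ + Ω η + 1) - A (φ + 1)))
          - 2 * α * β * γ * δ / η * (τ / (U (φ + 1) * U φ))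
          + 2 * α * β * γ * δ / η * (B (φ + Ω η + 1) - B (φ + 1))))
      =O[l] fun η => (1 / η) ^ 2 := by
  obtain ⟨-, a, b, -, -⟩ := hreg _ hτ
  have n : U φ ≠ 0 := (hreg φ hφ).2.2.2.1
  have n' : U (φ + 1) ≠ 0 := (hreg _ hφ₁).2.2.2.1
  have p₀ : U (φ + τ) = U φ := hper φ
  have p₁ : U (φ + τ + 1) = U (φ + 1) := by rw [add_right_comm]; exact hper _
  have k₁ : DifferentiableAt ℂ (fun z => U (z + 1)) (φ + τ) :=
    DifferentiableAt.fun_comp' (φ + τ) b.differentiableAt (by fun_prop)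
  have k₀ := a.differentiableAt
  have hlim : Tendsto (fun η => φ + Ω η) l (𝓝 (φ + τ)) := hΩ.const_add φ
  have hφΩ : (fun η => φ + Ω η - (φ + τ)) =O[l] fun η => 1 / η :=
    hΩO.congr_left fun η => by ring
  have d₁ : DifferentiableAt ℂ (fun z => 1 / U (z + 1) + 1 / U z) (φ + τ) :=
    ((differentiableAt_const _).div k₁ (by rwa [p₁])).add
      ((differentiableAt_const _).div k₀ (by rwa [p₀]))
  have d₂ : DifferentiableAt ℂ (fun z => 1 / (U (z + 1) * U z)) (φ + τ) :=
    (differentiableAt_const _).div (k₁.mul k₀) (by rw [p₀, p₁]; exact mul_ne_zero n' n)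
  -- By periodicity the values at φ + τ are those at φ, so the differences are O(Ω - τ) = O(1/η);
  -- the prefactor 1/η makes them O(η⁻²).
  have o₁ := (d₁.isBigO_sub.comp_tendsto hlim).trans hφΩ
  have o₂ := (d₂.isBigO_sub.comp_tendsto hlim).trans hφΩ
  simp only [Function.comp_def, p₀, p₁] at o₁ o₂
  have hb : (fun η => φ + Ω η + 4 / 3) =O[l] fun _ => (1 : ℂ) :=
    (hlim.add_const (4 / 3)).isBigO_one ℂ
  have hη := isBigO_refl (fun η : ℂ => 1 / η) l
  have q₁ := (hη.mul (hb.mul o₁)).const_mul_left ((α + β) * γ * δ)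
  have q₂ := (hη.mul (hb.mul o₂)).const_mul_left (2 * α * β * γ * δ)
  -- The cost of replacing Ω by τ in the terms linear in l - φ.
  have q₃ := (hη.mul hΩO).const_mul_left ((α + β) * γ * δ * (1 / U (φ + 1) + 1 / U φ)
    - 2 * α * β * γ * δ * (1 / (U (φ + 1) * U φ)))
  simp only [one_mul, ← sq] at q₁ q₂ q₃
  refine ((q₁.sub q₂).add q₃).congr_left fun η => ?_
  rw [energyCoeff_eq hA hB hφ hφ₁]
  simp only [div_eq_mul_inv, mul_inv]
  ring

end FirstOrderSolution

end QP3

/-! ### Assembly of the theorem -/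

theorem theorem2
    (α β γ δ ξ₀ φ a p : ℂ) (hξ₀ : ξ₀ ≠ 0)
    -- the elliptic leading-order solution and its periods
    (ω : Fin 2 → ℂ) (U : ℂ → ℂ) (hU : QP3.IsLeadingOrder α β γ δ ω U)
    (hadm : QP3.Admissible α β γ δ a p) (hUφ : U φ = a) (hUφ' : U (φ + 1) = p)
    (hU' : deriv U φ ≠ 0)
    -- the initial domain, and the domain reached from it by `M` iterations
    (D₀ : Set ℂ) (hD₀ : IsOpen D₀) (M : ℕ) (hφ : φ ∈ D₀)
    (hω : ∀ i, ∃ j : ℕ, j + 1 ≤ M ∧ φ + ω i - (j : ℂ) ∈ D₀)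
    (hreg : QP3.IsRegularOn γ δ U (QP3.iterates D₀ M))
    -- the solution, for `η` tending to infinity along `l`
    (l : Filter ℂ) (hl : l ≤ Bornology.cobounded ℂ) (w : ℂ → ℂ → ℂ)
    (hw : ∀ᶠ η in l, QP3.IsSolution ξ₀ (α / ξ₀) (β / ξ₀)
      (Complex.exp (η - 1 / 2) * γ) (Complex.exp (η - 1 / 2) * δ) η (QP3.iterates D₀ M) (w η))
    (hua : ∀ᶠ η in l, QP3.scaled w η φ = a) (hup : ∀ᶠ η in l, QP3.scaled w η (φ + 1) = p)
    -- its initial functions: `s = u - U` is of order `1 / η`, with any leading coefficient `σ`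
    (σ : ℂ → ℂ)
    (hinit : ∀ m ∈ QP3.iterates D₀ 1,
      (fun x : ℂ × ℂ => QP3.scaled w x.1 x.2 - U x.2 - σ x.2 / x.1)
        =O[l ×ˢ 𝓝 m] fun x => 1 / x.1 ^ 2)
    -- the sums from `φ`; their extension to non-integer ranges is the one given by `σ`
    (A B T : ℂ → ℂ)
    (hA : QP3.IsSum φ (QP3.iterates D₀ M) (QP3.sumTerm U) A)
    (hB : QP3.IsSum φ (QP3.iterates D₀ M) (QP3.prodTerm U) B)
    (hT : QP3.IsSum φ (QP3.iterates D₀ M) (QP3.nestedTerm α β γ δ φ U A B) T)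
    (hσ : ∀ m ∈ QP3.iterates D₀ 1, σ m = QP3.F γ δ U m * T m) :
    -- the leading-order behaviour of `s`
    (∀ m ∈ QP3.iterates D₀ M,
      (fun x : ℂ × ℂ => QP3.scaled w x.1 x.2 - U x.2 - QP3.sLead γ δ U T x.1 x.2)
        =O[l ×ˢ 𝓝 m] fun x => 1 / x.1 ^ 2) ∧
    ∀ i : Fin 2,
      (∃ Ω : ℂ → ℂ, QP3.IsApproxPeriod l (QP3.scaled w) φ (ω i) Ω) ∧
      ∀ Ω : ℂ → ℂ, QP3.IsApproxPeriod l (QP3.scaled w) φ (ω i) Ω →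
        -- the change of the energy
        ((fun η => QP3.energy α β γ δ (QP3.scaled w η) (φ + Ω η)
              - QP3.energy α β γ δ (QP3.scaled w η) φ
            - ((α + β) * γ * δ / η *
                  ((1 / U (φ + 1) + 1 / U φ) * ω i - (A (φ + Ω η + 1) - A (φ + 1)))
                - 2 * α * β * γ * δ / η * (ω i / (U (φ + 1) * U φ))
                + 2 * α * β * γ * δ / η * (B (φ + Ω η + 1) - B (φ + 1))))
          =O[l] fun η => 1 / η ^ 2) ∧
        -- the approximate-period in terms of `s` itself
        ((fun η => Ω η - (ω i - (QP3.scaled w η (φ + ω i) - U (φ + ω i)) / deriv U φ))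
          =o[l] fun η => QP3.scaled w η (φ + ω i) - U (φ + ω i)) ∧
        -- and in terms of the explicit leading-order behaviour of `s`
        ((fun η => Ω η - (ω i - QP3.sLead γ δ U T η (φ + ω i) / deriv U φ))
          =O[l] fun η => 1 / η ^ 2) := by
  have hO := QP3.isOpen_iterates hD₀ M
  have hM : 1 ≤ M := by obtain ⟨j, hj, -⟩ := hω 0; omega
  have hφD : φ ∈ QP3.iterates D₀ M := ⟨0, by omega, by simpa using hφ⟩
  have hφD₁ : φ + 1 ∈ QP3.iterates D₀ M := ⟨1, hM, by simpa using hφ⟩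
  have happ : ∀ m ∈ QP3.iterates D₀ M,
      QP3.Approx l (QP3.scaled w) U (fun m => QP3.F γ δ U m * T m) m := by
    intro m hm
    refine hU.approx_iterates hD₀ hreg hA hB hT hl ?_ ?_ hm
    · filter_upwards [hw] with η hη m h₁ h₂ h₃
      exact QP3.scaled_equation hξ₀ hη h₁ h₂ h₃
    · intro m hm hm₁
      refine ⟨QP3.isBigO_one_of_continuousAt (hreg m hm).2.1.continuousAt,
        QP3.isBigO_one_of_continuousAt (hreg.continuousAt_F_mul hT hm), ?_⟩
      refine (hinit m hm₁).congr' ?_ (.of_forall fun x => (one_div_pow _ _).symm)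
      filter_upwards [tendsto_snd.eventually
        ((QP3.isOpen_iterates hD₀ 1).eventually_mem hm₁)] with x hx
      rw [hσ _ hx]
      ring
  have hdiff : ∀ᶠ η in l, DifferentiableOn ℂ (QP3.scaled w η) (QP3.iterates D₀ M) := by
    filter_upwards [hw] with η hη
    exact hη.differentiableOn.const_mul _
  have hsLead : ∀ η m, QP3.sLead γ δ U T η m = 1 / η * (QP3.F γ δ U m * T m) := fun η m => by
    unfold QP3.sLead; ring
  refine ⟨fun m hm => ?_, fun i => ?_⟩
  · refine (happ m hm).remainder.congr (fun x => ?_) fun x => by rw [one_div_pow]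
    rw [hsLead]
  -- The bound j + 1 ≤ M keeps φ + ω_i + 1 in the domain, as the energy there requires.
  obtain ⟨hc, hc₁⟩ : φ + ω i ∈ QP3.iterates D₀ M ∧ φ + ω i + 1 ∈ QP3.iterates D₀ M := by
    obtain ⟨j, hj, hjD⟩ := hω i
    exact ⟨⟨j, by omega, hjD⟩, ⟨j + 1, hj, by convert hjD using 1; push_cast; ring⟩⟩
  have hper : Function.Periodic U (ω i) := hU.periodic i
  have hUa : AnalyticAt ℂ U (φ + ω i) := (hreg _ hc).2.1
  have hUc : U (φ + ω i) = a := (hper φ).trans hUφ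
  have hdU : deriv U (φ + ω i) = deriv U φ := by
    rw [← deriv_comp_add_const, show (fun x => U (x + ω i)) = U from funext hper]
  have hU'' : deriv U (φ + ω i) ≠ 0 := by rwa [hdU]
  have hac := happ _ hc
  constructor
  · obtain ⟨Z, hZ, hZlim⟩ := hac.exists_return hl hUa hU'' hO hc hdiff
    refine ⟨fun η => Z η - φ, ?_, by simpa using hZlim.sub_const φ⟩
    filter_upwards [hZ, hua] with η h₁ h₂
    rw [add_sub_cancel, h₁, h₂, hUc]
  · intro Ω hΩ
    have hZ : Tendsto (fun η => φ + Ω η) l (𝓝 (φ + ω i)) := hΩ.tendsto.const_add φ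
    have hret : ∀ᶠ η in l, QP3.scaled w η (φ + Ω η) = U (φ + ω i) := by
      filter_upwards [hΩ.returns, hua] with η h₁ h₂
      rw [h₁, h₂, hUc]
    refine ⟨?_, ?_, ?_⟩
    · have hΩO := (hac.return_isBigO hl hUa hO hc hdiff hU'' hZ hret).congr_left
        (f₂ := fun η => Ω η - ω i) fun η => by ring
      have h₁ := (hU.energy_isBigO hO hreg hA hB hT hl hc hc₁ hac (happ _ hc₁) hφD
        hφD₁).comp_tendsto (QP3.tendsto_prodMk hZ)
      have h₂ := QP3.energy_change_isBigO (α := α) (β := β) hreg hA hB hper hc hφD hφD₁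
        hΩ.tendsto hΩO
      refine (h₁.add h₂).congr' ?_ (.of_forall fun η => one_div_pow _ _)
      filter_upwards [hua, hup] with η ha hp
      -- Equal initial values give equal initial energies, so the energy change is the first-order
      -- coefficient alone, up to O(η⁻²).
      have hE : QP3.energy α β γ δ (QP3.scaled w η) φ = QP3.energy α β γ δ U φ := by
        unfold QP3.energy; rw [ha, hp, hUφ, hUφ']
      rw [hE]
      simp only [Function.comp]
      ring
    · refine (hac.return_isLittleO hl hUa hO hc hdiff hU'' hZ hret).congr_left fun η => ?_
      rw [hdU]; ring
    · refine (hac.return_firstOrder hl hUa hO hc hdiff hU'' hZ hret).congr (fun η => ?_)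
        fun η => one_div_pow _ _
      rw [hdU, hsLead]; ring
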